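/- Let $U$ be an ultrafilter on a set $I$, and for a set $S$ let ${}^*S=S^I/\!\sim$ be its ultrapower with respect to $U$. For $d\ge 0$ and an open set $\Omega\subseteq\mathbb R^d$ let $\mathcal E(\Omega)=C^\infty(\Omega,\mathbb C)$. An element $\langle f_i\rangle\in{}^*\mathcal E(\Omega)$ is evaluated at points of ${}^*\Omega=\{\langle x_i\rangle\in{}^*\mathbb R^d: x_i\in\Omega \text{ for } U\text{-almost all } i\}$ by $\langle f_i\rangle(\langle x_i\rangle)=\langle f_i(x_i)\rangle$, and $\partial^\alpha\langle f_i\rangle=\langle\partial^\alpha f_i\rangle$ for $\alpha\in\mathbb N_0^d$. For $\mathcal O\subseteq\Omega$ open, $\langle f_i\rangle|{}^*\mathcal O=\langle f_i|\mathcal O\rangle\in{}^*\mathcal E(\mathcal O)$. Let $\mu(\Omega)=\{r+dx: r\in\Omega,\ dx\in{}^*\mathbb R^d,\ \|dx\|\approx 0\}$ be the monad of $\Omega$. Let $\mathcal M$ be a convex subring of ${}^*\mathbb C$ (a subring with $1$ such that $z\in{}^*\mathbb C$, $\zeta\in\mathcal M$, $|z|\le|\zeta|$ imply $z\in\mathcal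 M$), and let $\mathcal M_0=\{z\in\mathcal M: z=0\text{ or }1/z\notin\mathcal M\}$. Put $$\mathcal M(\Omega)=\{f\in{}^*\mathcal E(\Omega):\ \partial^\alpha f(x)\in\mathcal M\ \text{ for all }\alpha\in\mathbb N_0^d,\ x\in\mu(\Omega)\},$$ $$\mathcal M_0(\Omega)=\{f\in{}^*\mathcal E(\Omega):\ \partial^\alpha f(x)\in\mathcal M_0\ \text{ for all }\alpha\in\mathbb N_0^d,\ x\in\mu(\Omega)\},$$ and let $\widehat{\mathcal M}(\Omega)=\mathcal M(\Omega)/\mathcal M_0(\Omega)$ be the ring of $\mathcal M$-asymptotic functions on $\Omega$, where $\widehat f$ is the class of $f\in\mathcal M(\Omega)$. Put $\partial^\alpha\widehat f=\widehat{\partial^\alpha f}$, and for $\mathcal O\subseteq\Omega$ open define the restriction $\widehat f\restriction\mathcal O=\widehat{f|{}^*\mathcal O}\in\widehat{\mathcal M}(\mathcal O)$. **Theorem.** The family $\{\widehat{\mathcal M}(\Omega)\}$, indexed by the open sets $\Omega\subseteq\mathbb R^d$, is a sheaf of differential rings on $\mathbb R^d$ under $\restriction$. That is, each $\widehat{\mathcal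 M}(\Omega)$ is a commutative differential ring (the maps $\partial^\alpha$ are additive, $\partial^0=\mathrm{id}$, $\partial^{\alpha+\beta}=\partial^\alpha\partial^\beta$, and the first-order ones satisfy the Leibniz rule), and: (i) $\widehat f\restriction\Omega=\widehat f$ for all $\widehat f\in\widehat{\mathcal M}(\Omega)$. (ii) If $\Omega_1\subseteq\Omega_2\subseteq\Omega$ are open, then $(\widehat f\restriction\Omega_2)\restriction\Omega_1=\widehat f\restriction\Omega_1$ for all $\widehat f\in\widehat{\mathcal M}(\Omega)$. Let $\Omega=\bigcup_{\lambda\in\Lambda}\Omega_\lambda$ be an open covering, with an arbitrary index set $\Lambda$. Then: (iii) If $\widehat f\in\widehat{\mathcal M}(\Omega)$ and $\widehat f\restriction\Omega_\lambda=0$ for all $\lambda\in\Lambda$, then $\widehat f=0$. (iv) If $\widehat f_\lambda\in\widehat{\mathcal M}(\Omega_\lambda)$ $(\lambda\in\Lambda)$ satisfy $\widehat f_{\lambda_1}\restriction(\Omega_{\lambda_1}\cap\Omega_{\lambda_2})=\widehat f_{\lambda_2}\restriction(\Omega_{\lambda_1}\cap\Omega_{\lambda_2})$ whenever $\Omega_{\lambda_1}\cap\Omega_{\lambda_2}\ne\varnothing$,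 then there is $\widehat f\in\widehat{\mathcal M}(\Omega)$ with $\widehat f\restriction\Omega_\lambda=\widehat f_\lambda$ for all $\lambda\in\Lambda$. (v) For open $\mathcal O\subseteq\Omega$, $\widehat f,\widehat g\in\widehat{\mathcal M}(\Omega)$ and $\alpha\in\mathbb N_0^d$: $(\partial^\alpha\widehat f)\restriction\mathcal O=\partial^\alpha(\widehat f\restriction\mathcal O)$, $(\widehat f+\widehat g)\restriction\mathcal O=\widehat f\restriction\mathcal O+\widehat g\restriction\mathcal O$ and $(\widehat f\,\widehat g)\restriction\mathcal O=(\widehat f\restriction\mathcal O)(\widehat g\restriction\mathcal O)$. Consequently, for every $\widehat f\in\widehat{\mathcal M}(\Omega)$ there is a largest open set $\mathcal O\subseteq\Omega$ with $\widehat f\restriction\mathcal O=0$, and the support $\operatorname{supp}\widehat f=\Omega\setminus\mathcal O$ is closed in $\Omega$. -/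

import Mathlib

open Filter Topology TopologicalSpace
open scoped ContDiff

noncomputable section

namespace AsymptoticFunctions

universe u

/-! ### Smooth functions on an open set -/

/-- The Euclidean space `ℝ^d`. -/
abbrev Eucl (d : ℕ) : Type := EuclideanSpace ℝ (Fin d)

variable {d : ℕ}

open Classical in
/-- Extension by zero of a function on `Ω` to all of `ℝ^d`. Only its values at points of `Ω` (and
its germs there) are ever used. -/
def extend (Ω : Opens (Eucl d)) (f : Ω → ℂ) : Eucl d → ℂ :=
  fun x => if h : x ∈ Ω then f ⟨x, h⟩ else 0

theorem extend_of_mem {Ω : Opens (Eucl d)} (f : Ω → ℂ) {x : Eucl d} (h : x ∈ Ω) :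
    extend Ω f x = f ⟨x, h⟩ := dif_pos h

theorem extend_add (Ω : Opens (Eucl d)) (f g : Ω → ℂ) :
    extend Ω (f + g) = extend Ω f + extend Ω g := by
  funext x; by_cases h : x ∈ Ω <;> simp [extend, h]

theorem extend_mul (Ω : Opens (Eucl d)) (f g : Ω → ℂ) :
    extend Ω (f * g) = extend Ω f * extend Ω g := by
  funext x; by_cases h : x ∈ Ω <;> simp [extend, h]

theorem extend_smul (Ω : Opens (Eucl d)) (c : ℂ) (f : Ω → ℂ) :
    extend Ω (c • f) = c • extend Ω f := by
  funext x; by_cases h : x ∈ Ω <;> simp [extend, h]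

/-- `𝓔(Ω) = C^∞(Ω)`: the algebra of complex valued smooth functions on `Ω`, with the pointwise
operations. -/
def Smooth (Ω : Opens (Eucl d)) : Subalgebra ℂ (Ω → ℂ) where
  carrier := {f | ContDiffOn ℝ ∞ (extend Ω f) (Ω : Set (Eucl d))}
  mul_mem' {f g} hf hg := by
    have : ContDiffOn ℝ ∞ (fun x => extend Ω f x * extend Ω g x) (Ω : Set (Eucl d)) := hf.mul hg
    simp only [Set.mem_ofPred_eq, extend_mul]; exact this
  add_mem' {f g} hf hg := by
    have : ContDiffOn ℝ ∞ (fun x => extend Ω f x + extend Ω g x) (Ω : Set (Eucl d)) := hf.add hg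
    simp only [Set.mem_ofPred_eq, extend_add]; exact this
  algebraMap_mem' c := by
    have : ContDiffOn ℝ ∞ (fun _ : Eucl d => c) (Ω : Set (Eucl d)) := contDiffOn_const
    exact this.congr fun x hx => by rw [extend_of_mem _ hx]; rfl

theorem smooth_contDiffAt {Ω : Opens (Eucl d)} (f : Smooth Ω) {x : Eucl d} (hx : x ∈ Ω) :
    ContDiffAt ℝ ∞ (extend Ω f) x :=
  ContDiffOn.contDiffAt f.2 (Ω.2.mem_nhds hx)

theorem smooth_differentiableAt {Ω : Opens (Eucl d)} (f : Smooth Ω) {x : Eucl d} (hx : x ∈ Ω) :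
    DifferentiableAt ℝ (extend Ω f) x :=
  (smooth_contDiffAt f hx).differentiableAt (by simp)

/-- The partial derivative `∂/∂xᵢ` on `𝓔(Ω)`. -/
def pderiv {Ω : Opens (Eucl d)} (i : Fin d) : Module.End ℂ (Smooth Ω) where
  toFun f := ⟨fun x => fderiv ℝ (extend Ω f) x (EuclideanSpace.single i 1), by
    have h1 : ContDiffOn ℝ ∞ (fderiv ℝ (extend Ω f)) (Ω : Set (Eucl d)) :=
      ContDiffOn.fderiv_of_isOpen f.2 Ω.2 (by simp)
    have h2 : ContDiffOn ℝ ∞ (fun x => fderiv ℝ (extend Ω f) x (EuclideanSpace.single i 1))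
        (Ω : Set (Eucl d)) := h1.clm_apply contDiffOn_const
    exact h2.congr fun x hx => extend_of_mem _ hx⟩
  map_add' f g := by
    ext x
    change fderiv ℝ (extend Ω ((f : Ω → ℂ) + (g : Ω → ℂ))) x _ = _
    rw [extend_add, fderiv_add (smooth_differentiableAt f x.2) (smooth_differentiableAt g x.2)]
    rfl
  map_smul' c f := by
    ext x
    change fderiv ℝ (extend Ω (c • (f : Ω → ℂ))) x _ = _
    rw [extend_smul, fderiv_const_smul (smooth_differentiableAt f x.2)]
    rfl

theorem pderiv_apply {Ω : Opens (Eucl d)} (i : Fin d) (f : Smooth Ω) (x : Ω) :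
    (pderiv i f : Ω → ℂ) x = fderiv ℝ (extend Ω f) x (EuclideanSpace.single i 1) := rfl

theorem pderiv_mul {Ω : Opens (Eucl d)} (i : Fin d) (f g : Smooth Ω) :
    pderiv i (f * g) = pderiv i f * g + f * pderiv i g := by
  ext x
  change fderiv ℝ (extend Ω ((f : Ω → ℂ) * (g : Ω → ℂ))) x _ =
    fderiv ℝ (extend Ω f) x (EuclideanSpace.single i 1) * (g : Ω → ℂ) x +
      (f : Ω → ℂ) x * fderiv ℝ (extend Ω g) x (EuclideanSpace.single i 1)
  rw [extend_mul, fderiv_mul (smooth_differentiableAt f x.2) (smooth_differentiableAt g x.2)]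
  simp only [add_apply, smul_apply, smul_eq_mul,
    extend_of_mem _ x.2]
  ring

theorem extend_pderiv {Ω : Opens (Eucl d)} (i : Fin d) (f : Smooth Ω) {x : Eucl d} (hx : x ∈ Ω) :
    extend Ω (pderiv i f : Smooth Ω) =ᶠ[𝓝 x]
      fun y => fderiv ℝ (extend Ω f) y (EuclideanSpace.single i 1) := by
  filter_upwards [Ω.2.mem_nhds hx] with y hy
  rw [extend_of_mem _ hy]; rfl

theorem pderiv_pderiv_apply {Ω : Opens (Eucl d)} (i j : Fin d) (f : Smooth Ω) (x : Ω) :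
    (pderiv i (pderiv j f) : Ω → ℂ) x =
      fderiv ℝ (fderiv ℝ (extend Ω f)) x (EuclideanSpace.single i 1)
        (EuclideanSpace.single j 1) := by
  rw [pderiv_apply, (extend_pderiv j f x.2).fderiv_eq]
  have hd : DifferentiableAt ℝ (fderiv ℝ (extend Ω f)) x :=
    ((smooth_contDiffAt f x.2).fderiv_right (m := ∞) (by simp)).differentiableAt (by simp)
  rw [fderiv_clm_apply hd (differentiableAt_const _)]
  simp

theorem pderiv_comm {Ω : Opens (Eucl d)} (i j : Fin d) :
    Commute (pderiv i : Module.End ℂ (Smooth Ω)) (pderiv j) := by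
  refine LinearMap.ext fun f => ?_
  ext x
  change (pderiv i (pderiv j f) : Ω → ℂ) x = (pderiv j (pderiv i f) : Ω → ℂ) x
  rw [pderiv_pderiv_apply, pderiv_pderiv_apply]
  exact ((smooth_contDiffAt f x.2).isSymmSndFDerivAt (by
    rw [minSmoothness_of_isRCLikeNormedField]
    exact WithTop.coe_le_coe.2 le_top)).eq _ _

theorem pderiv_pairwise {Ω : Opens (Eucl d)} (α β : Fin d → ℕ) (s : Set (Fin d)) :
    s.Pairwise fun i j => Commute ((pderiv i : Module.End ℂ (Smooth Ω)) ^ α i) (pderiv j ^ β j) :=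
  fun i _ j _ _ => (pderiv_comm i j).pow_pow (α i) (β j)

/-- The partial derivative `∂^α = ∏ᵢ (∂/∂xᵢ)^αᵢ` on `𝓔(Ω)`, for a multi-index `α ∈ ℕ₀^d`. The
factors commute. -/
def mderiv {Ω : Opens (Eucl d)} (α : Fin d → ℕ) : Module.End ℂ (Smooth Ω) :=
  Finset.univ.noncommProd (fun i => pderiv i ^ α i)
    (pderiv_pairwise α α _)

theorem mderiv_zero {Ω : Opens (Eucl d)} : (mderiv 0 : Module.End ℂ (Smooth Ω)) = 1 := by
  unfold mderiv
  rw [Finset.noncommProd_eq_pow_card _ _ _ 1 (by simp)]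
  simp

theorem mderiv_add {Ω : Opens (Eucl d)} (α β : Fin d → ℕ) :
    (mderiv (α + β) : Module.End ℂ (Smooth Ω)) = mderiv α * mderiv β := by
  unfold mderiv
  rw [← Finset.noncommProd_mul_distrib]
  · exact Finset.noncommProd_congr rfl (fun i _ => by rw [Pi.add_apply, pow_add]; rfl) _
  · exact pderiv_pairwise β α _

theorem mderiv_single {Ω : Opens (Eucl d)} (i : Fin d) :
    (mderiv (Pi.single i 1) : Module.End ℂ (Smooth Ω)) = pderiv i := by
  unfold mderiv
  refine (Finset.mul_noncommProd_erase Finset.univ (Finset.mem_univ i) _ _).symm.trans ?_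
  refine (congrArg₂ (· * ·) (Eq.trans ?_ (pow_one (pderiv i)))
    ((Finset.noncommProd_eq_pow_card _ _ _ 1 ?_).trans (one_pow _))).trans (mul_one _)
  · rw [Pi.single_eq_same]
  · intro j hj
    rw [Pi.single_eq_of_ne (Finset.ne_of_mem_erase hj), pow_zero]

/-- The pointwise restriction `f ↦ f|𝓞` from `𝓔(Ω)` to `𝓔(𝓞)`, for `𝓞 ⊆ Ω`. -/
def Smooth.restrict {O Ω : Opens (Eucl d)} (h : O ≤ Ω) : Smooth Ω →+* Smooth O where
  toFun f := ⟨fun x => (f : Ω → ℂ) ⟨x, h x.2⟩, by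
    have h1 : ContDiffOn ℝ ∞ (extend Ω f) (O : Set (Eucl d)) :=
      ContDiffOn.mono (t := (O : Set (Eucl d))) f.2 h
    exact h1.congr fun x hx => by rw [extend_of_mem _ hx, extend_of_mem _ (h hx)]⟩
  map_one' := rfl
  map_mul' _ _ := rfl
  map_zero' := rfl
  map_add' _ _ := rfl

theorem extend_restrict {O Ω : Opens (Eucl d)} (h : O ≤ Ω) (f : Smooth Ω) {x : Eucl d}
    (hx : x ∈ O) : extend O (Smooth.restrict h f) x = extend Ω f x := by
  rw [extend_of_mem _ hx, extend_of_mem _ (h hx)]; rfl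

theorem pderiv_restrict {O Ω : Opens (Eucl d)} (h : O ≤ Ω) (i : Fin d) (f : Smooth Ω) :
    pderiv i (Smooth.restrict h f) = Smooth.restrict h (pderiv i f) := by
  ext x
  change fderiv ℝ (extend O (Smooth.restrict h f)) x _ = fderiv ℝ (extend Ω f) x _
  have : extend O (Smooth.restrict h f) =ᶠ[𝓝 (x : Eucl d)] extend Ω f := by
    filter_upwards [O.2.mem_nhds x.2] with y hy using extend_restrict h f hy
  rw [this.fderiv_eq]

/-- Induction on multi-indices. -/
theorem multiindex_induction {p : (Fin d → ℕ) → Prop} (h0 : p 0)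
    (h1 : ∀ α i, p α → p (α + Pi.single i 1)) (α : Fin d → ℕ) : p α := by
  obtain ⟨n, hn⟩ : ∃ n, ∑ i, α i = n := ⟨_, rfl⟩
  induction n generalizing α with
  | zero =>
    have : α = 0 := by
      funext i
      exact (Finset.sum_eq_zero_iff.1 hn) i (Finset.mem_univ i)
    exact this ▸ h0
  | succ n ih =>
    obtain ⟨i, hi⟩ : ∃ i, α i ≠ 0 := by
      by_contra! hc
      simp [hc] at hn
    have hα : α = (α - Pi.single i 1) + Pi.single i 1 := by
      funext j
      by_cases hj : j = i
      · subst hj; simp; omega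
      · simp [hj]
    rw [hα]
    apply h1
    apply ih
    have h2 : ∑ j, α j = ∑ j, ((α - Pi.single i 1 : Fin d → ℕ) j + (Pi.single i 1 : Fin d → ℕ) j) :=
      Finset.sum_congr rfl fun j _ => congrFun hα j
    rw [Finset.sum_add_distrib] at h2
    simp only [Finset.sum_pi_single', Finset.mem_univ, if_true] at h2
    omega

theorem mderiv_add_single {Ω : Opens (Eucl d)} (α : Fin d → ℕ) (i : Fin d) (f : Smooth Ω) :
    mderiv (α + Pi.single i 1) f = mderiv α (pderiv i f) := by
  rw [mderiv_add, mderiv_single]; rfl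

theorem mderiv_restrict {O Ω : Opens (Eucl d)} (h : O ≤ Ω) (α : Fin d → ℕ) (f : Smooth Ω) :
    mderiv α (Smooth.restrict h f) = Smooth.restrict h (mderiv α f) := by
  induction α using multiindex_induction generalizing f with
  | h0 => simp [mderiv_zero]
  | h1 α i ih => rw [mderiv_add_single, mderiv_add_single, pderiv_restrict, ih]

/-! ### Non-standard numbers, points and smooth functions -/

variable {ι : Type u}

/-- The non-standard extension `*S = S^ι / ∼` of a set `S`: families `(sᵢ)` modulo equality almost
everywhere with respect to the ultrafilter `U`. All operations and relations are inherited from `S`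
by representatives. -/
abbrev NonStd (U : Ultrafilter ι) (S : Type*) := Germ (U : Filter ι) S

/-- The absolute value `|⟨zᵢ⟩| = ⟨|zᵢ|⟩`, or the Euclidean norm `‖⟨xᵢ⟩‖ = ⟨‖xᵢ‖⟩`, with values in
`*ℝ`. -/
def absval {U : Ultrafilter ι} {S : Type*} [Norm S] (z : NonStd U S) : NonStd U ℝ :=
  Germ.map (fun a => ‖a‖) z

/-- `x ∈ *ℝ^d` is infinitesimal, `‖x‖ ≈ 0`: its norm is below every standard positive real. -/
def IsInfinitesimal {U : Ultrafilter ι} (x : NonStd U (Eucl d)) : Prop :=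
  ∀ ε : ℝ, 0 < ε → absval x < (ε : NonStd U ℝ)

/-- The monad `μ(X) = {r + dx : r ∈ X, dx ∈ *ℝ^d, ‖dx‖ ≈ 0}` of `X ⊆ ℝ^d`. -/
def monad (U : Ultrafilter ι) (X : Set (Eucl d)) : Set (NonStd U (Eucl d)) :=
  {x | ∃ r ∈ X, ∃ dx : NonStd U (Eucl d), IsInfinitesimal dx ∧ x = (r : NonStd U (Eucl d)) + dx}

/-- The non-standard extension `*X ⊆ *ℝ^d` of `X ⊆ ℝ^d`. -/
def starSet (U : Ultrafilter ι) (X : Set (Eucl d)) : Set (NonStd U (Eucl d)) :=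
  {x | Germ.LiftPred (· ∈ X) x}

theorem monad_mono (U : Ultrafilter ι) {X Y : Set (Eucl d)} (h : X ⊆ Y) :
    monad U X ⊆ monad U Y := by
  rintro x ⟨r, hr, dx, hdx, rfl⟩
  exact ⟨r, h hr, dx, hdx, rfl⟩

theorem monad_subset_starSet (U : Ultrafilter ι) (Ω : Opens (Eucl d)) :
    monad U (Ω : Set (Eucl d)) ⊆ starSet U Ω := by
  rintro x ⟨r, hr, dx, hdx, rfl⟩
  obtain ⟨ε, hε, hb⟩ := Metric.isOpen_iff.1 Ω.2 r hr
  have h := hdx ε hε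
  induction dx using Germ.inductionOn with
  | h v =>
    have h' : ∀ᶠ i in (U : Filter ι), ‖v i‖ < ε := Germ.coe_lt.1 h
    change ∀ᶠ i in (U : Filter ι), r + v i ∈ (Ω : Set (Eucl d))
    filter_upwards [h'] with i hi
    apply hb
    simpa [dist_eq_norm] using hi

/-- The non-standard smooth functions `*𝓔(Ω) = 𝓔(Ω)^ι / ∼`. -/
abbrev NonStdSmooth (U : Ultrafilter ι) (Ω : Opens (Eucl d)) := NonStd U (Smooth Ω)

/-- The value `⟨fᵢ⟩(⟨xᵢ⟩) = ⟨fᵢ(xᵢ)⟩` of a non-standard smooth function at a point of `*Ω`. (Points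
`x ∉ *Ω` give the value `0`, which is never used.) -/
def eval {U : Ultrafilter ι} {Ω : Opens (Eucl d)} (f : NonStdSmooth U Ω)
    (x : NonStd U (Eucl d)) : NonStd U ℂ :=
  Germ.map₂ (fun (g : Smooth Ω) y => extend Ω g y) f x

/-- `∂^α ⟨fᵢ⟩ = ⟨∂^α fᵢ⟩`. -/
def starDeriv {U : Ultrafilter ι} {Ω : Opens (Eucl d)} (α : Fin d → ℕ) :
    NonStdSmooth U Ω →+ NonStdSmooth U Ω where
  toFun := Germ.map (mderiv α)
  map_zero' := congrArg (fun g : Smooth Ω => (g : NonStdSmooth U Ω)) (map_zero (mderiv α))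
  map_add' f g := by
    induction f, g using Germ.inductionOn₂ with
    | h f g => exact congrArg Germ.ofFun (funext fun i => map_add (mderiv α) (f i) (g i))

/-- The restriction `⟨fᵢ⟩ | *𝓞 = ⟨fᵢ | 𝓞⟩` from `*𝓔(Ω)` to `*𝓔(𝓞)`. -/
def starRestrict (U : Ultrafilter ι) {O Ω : Opens (Eucl d)} (h : O ≤ Ω) :
    NonStdSmooth U Ω →+* NonStdSmooth U O where
  toFun := Germ.map (Smooth.restrict h)
  map_one' := rfl
  map_zero' := rfl
  map_add' f g := by
    induction f, g using Germ.inductionOn₂ with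
    | h f g => rfl
  map_mul' f g := by
    induction f, g using Germ.inductionOn₂ with
    | h f g => rfl

section NonStdLemmas

variable {U : Ultrafilter ι} {Ω O : Opens (Eucl d)}

theorem eval_add (f g : NonStdSmooth U Ω) (x : NonStd U (Eucl d)) :
    eval (f + g) x = eval f x + eval g x := by
  induction f, g, x using Germ.inductionOn₃ with
  | H f g x =>
    exact congrArg Germ.ofFun (funext fun i => congrFun (extend_add Ω (f i) (g i)) (x i))

theorem eval_mul (f g : NonStdSmooth U Ω) (x : NonStd U (Eucl d)) :
    eval (f * g) x = eval f x * eval g x := by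
  induction f, g, x using Germ.inductionOn₃ with
  | H f g x =>
    exact congrArg Germ.ofFun (funext fun i => congrFun (extend_mul Ω (f i) (g i)) (x i))

theorem eval_zero (x : NonStd U (Eucl d)) : eval (0 : NonStdSmooth U Ω) x = 0 := by
  have h := eval_add (0 : NonStdSmooth U Ω) 0 x
  rw [add_zero] at h
  exact left_eq_add.1 h

theorem eval_one {x : NonStd U (Eucl d)} (hx : x ∈ starSet U (Ω : Set (Eucl d))) :
    eval (1 : NonStdSmooth U Ω) x = 1 := by
  induction x using Germ.inductionOn with
  | h x =>
    have hx' : ∀ᶠ i in (U : Filter ι), x i ∈ Ω := hx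
    refine Germ.coe_eq.2 ?_
    filter_upwards [hx'] with i hi
    exact extend_of_mem _ hi

theorem eval_neg (f : NonStdSmooth U Ω) (x : NonStd U (Eucl d)) :
    eval (-f) x = -eval f x := by
  have h := eval_add f (-f) x
  rw [add_neg_cancel, eval_zero] at h
  exact eq_neg_of_add_eq_zero_right h.symm

theorem eval_starRestrict (h : O ≤ Ω) (f : NonStdSmooth U Ω) {x : NonStd U (Eucl d)}
    (hx : x ∈ starSet U (O : Set (Eucl d))) : eval (starRestrict U h f) x = eval f x := by
  induction f, x using Germ.inductionOn₂ with
  | h f x =>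
    have hx' : ∀ᶠ i in (U : Filter ι), x i ∈ O := hx
    refine Germ.coe_eq.2 ?_
    filter_upwards [hx'] with i hi
    exact extend_restrict h (f i) hi

theorem starDeriv_zero (f : NonStdSmooth U Ω) : starDeriv 0 f = f := by
  induction f using Germ.inductionOn with
  | h f => exact congrArg Germ.ofFun (funext fun i => by simp [mderiv_zero])

theorem starDeriv_add (α β : Fin d → ℕ) (f : NonStdSmooth U Ω) :
    starDeriv (α + β) f = starDeriv α (starDeriv β f) := by
  induction f using Germ.inductionOn with
  | h f => exact congrArg Germ.ofFun (funext fun i => by simp [mderiv_add])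

theorem starDeriv_single_mul (i : Fin d) (f g : NonStdSmooth U Ω) :
    starDeriv (Pi.single i 1) (f * g) =
      starDeriv (Pi.single i 1) f * g + f * starDeriv (Pi.single i 1) g := by
  induction f, g using Germ.inductionOn₂ with
  | h f g =>
    refine congrArg Germ.ofFun (funext fun j => ?_)
    simp [mderiv_single, pderiv_mul]

theorem starDeriv_starRestrict (h : O ≤ Ω) (α : Fin d → ℕ) (f : NonStdSmooth U Ω) :
    starDeriv α (starRestrict U h f) = starRestrict U h (starDeriv α f) := by
  induction f using Germ.inductionOn with
  | h f => exact congrArg Germ.ofFun (funext fun i => mderiv_restrict h α (f i))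

/-- If all derivatives of `f` take values in `A` and all derivatives of `g` take values in `B`, and
`A * B ⊆ C`, then all derivatives of `f * g` take values in `C`. -/
theorem eval_starDeriv_mul_mem {A B : Set (NonStd U ℂ)} {C : AddSubgroup (NonStd U ℂ)}
    (hAB : ∀ a ∈ A, ∀ b ∈ B, a * b ∈ C) {x : NonStd U (Eucl d)} (α : Fin d → ℕ)
    (f g : NonStdSmooth U Ω) (hf : ∀ β, eval (starDeriv β f) x ∈ A)
    (hg : ∀ β, eval (starDeriv β g) x ∈ B) : eval (starDeriv α (f * g)) x ∈ C := by
  induction α using multiindex_induction generalizing f g with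
  | h0 =>
    have h1 := hf 0
    have h2 := hg 0
    rw [starDeriv_zero] at h1 h2 ⊢
    rw [eval_mul]
    exact hAB _ h1 _ h2
  | h1 α i ih =>
    rw [starDeriv_add, starDeriv_single_mul, map_add, eval_add]
    refine C.add_mem (ih _ _ (fun β => ?_) hg) (ih _ _ hf fun β => ?_)
    · rw [← starDeriv_add]; exact hf _
    · rw [← starDeriv_add]; exact hg _

theorem starDeriv_one {α : Fin d → ℕ} {x : NonStd U (Eucl d)}
    (hx : x ∈ starSet U (Ω : Set (Eucl d))) :
    eval (starDeriv α (1 : NonStdSmooth U Ω)) x = 0 ∨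
      eval (starDeriv α (1 : NonStdSmooth U Ω)) x = 1 := by
  induction α using multiindex_induction with
  | h0 => right; rw [starDeriv_zero, eval_one hx]
  | h1 α i ih =>
    left
    have h := starDeriv_single_mul i (1 : NonStdSmooth U Ω) 1
    rw [mul_one, mul_one, one_mul] at h
    rw [starDeriv_add, left_eq_add.1 h, map_zero, eval_zero]

theorem absval_mul (z w : NonStd U ℂ) : absval (z * w) = absval z * absval w := by
  induction z, w using Germ.inductionOn₂ with
  | h z w => exact congrArg Germ.ofFun (funext fun i => norm_mul (z i) (w i))

theorem absval_inv (z : NonStd U ℂ) : absval z⁻¹ = (absval z)⁻¹ := by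
  induction z using Germ.inductionOn with
  | h z => exact congrArg Germ.ofFun (funext fun i => norm_inv (z i))

theorem absval_add_le (z w : NonStd U ℂ) : absval (z + w) ≤ absval z + absval w := by
  induction z, w using Germ.inductionOn₂ with
  | h z w => exact Germ.coe_le.2 (Eventually.of_forall fun i => norm_add_le (z i) (w i))

theorem absval_two : absval (2 : NonStd U ℂ) = 2 := by
  change ((‖(2 : ℂ)‖ : ℝ) : NonStd U ℝ) = ((2 : ℝ) : NonStd U ℝ)
  simp

theorem absval_nonneg (z : NonStd U ℂ) : 0 ≤ absval z := by
  induction z using Germ.inductionOn with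
  | h z => exact Germ.coe_le.2 (Eventually.of_forall fun i => norm_nonneg (z i))

theorem absval_neg (z : NonStd U ℂ) : absval (-z) = absval z := by
  induction z using Germ.inductionOn with
  | h z => exact congrArg Germ.ofFun (funext fun i => norm_neg (z i))

theorem absval_pos {z : NonStd U ℂ} (hz : z ≠ 0) : 0 < absval z := by
  refine lt_of_le_of_ne (absval_nonneg z) fun h => ?_
  have h1 : absval z * absval z⁻¹ = 1 := by
    rw [← absval_mul, mul_inv_cancel₀ hz]
    change ((‖(1 : ℂ)‖ : ℝ) : NonStd U ℝ) = ((1 : ℝ) : NonStd U ℝ)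
    simp
  rw [← h, zero_mul] at h1
  exact zero_ne_one h1

end NonStdLemmas

/-! ### Convex subrings of `*ℂ` -/

/-- A convex subring `𝓜` of `*ℂ`: `|z| ≤ |ζ|` and `ζ ∈ 𝓜` imply `z ∈ 𝓜`. -/
structure ConvexSubring (U : Ultrafilter ι) extends Subring (NonStd U ℂ) where
  convex' : ∀ z ζ : NonStd U ℂ, ζ ∈ carrier → absval z ≤ absval ζ → z ∈ carrier

/-- The set `𝓜₀ = {z ∈ 𝓜 : z = 0 or 1/z ∉ 𝓜}` of non-invertible elements of `𝓜`, which is an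
additive subgroup (indeed an ideal of `𝓜`). -/
def ConvexSubring.nonInv {U : Ultrafilter ι} (M : ConvexSubring U) :
    AddSubgroup (NonStd U ℂ) where
  carrier := {z | z ∈ M.toSubring ∧ (z = 0 ∨ z⁻¹ ∉ M.toSubring)}
  zero_mem' := ⟨zero_mem _, Or.inl rfl⟩
  neg_mem' := by
    rintro z ⟨h1, h2⟩
    refine ⟨neg_mem h1, ?_⟩
    rwa [neg_eq_zero, inv_neg, neg_mem_iff]
  add_mem' := by
    have key : ∀ z w : NonStd U ℂ, (w = 0 ∨ w⁻¹ ∉ M.toSubring) → absval z ≤ absval w →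
        z + w ≠ 0 → (z + w)⁻¹ ∈ M.toSubring → False := by
      intro z w hw hzw h0 hinv
      have hw0 : w ≠ 0 := by
        rintro rfl
        have h1 : absval (z + 0) ≤ absval (0 : NonStd U ℂ) := by rwa [add_zero]
        have h2 : absval (0 : NonStd U ℂ) = 0 := by
          change ((‖(0 : ℂ)‖ : ℝ) : NonStd U ℝ) = ((0 : ℝ) : NonStd U ℝ)
          simp
        exact absurd (absval_pos h0) (not_lt.2 (h2 ▸ h1))
      refine hw.elim hw0 fun hw' => hw' ?_
      refine M.convex' _ (2 * (z + w)⁻¹) (M.toSubring.mul_mem ?_ hinv) ?_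
      · have := M.toSubring.add_mem M.toSubring.one_mem M.toSubring.one_mem
        rwa [one_add_one_eq_two] at this
      · have p1 := absval_pos h0
        have p2 := absval_pos hw0
        rw [absval_mul, absval_inv, absval_inv, absval_two, ← div_eq_mul_inv, inv_eq_one_div,
          div_le_div_iff₀ p2 p1, one_mul]
        calc absval (z + w) ≤ absval z + absval w := absval_add_le z w
          _ ≤ absval w + absval w := by gcongr
          _ = 2 * absval w := (two_mul _).symm
    rintro z w ⟨hz1, hz2⟩ ⟨hw1, hw2⟩
    refine ⟨add_mem hz1 hw1, ?_⟩
    by_contra! hc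
    rcases le_total (absval z) (absval w) with h | h
    · exact key z w hw2 h hc.1 hc.2
    · rw [add_comm] at hc
      exact key w z hz2 h hc.1 hc.2

theorem ConvexSubring.mul_nonInv {U : Ultrafilter ι} (M : ConvexSubring U) :
    ∀ z ∈ (M.toSubring : Set (NonStd U ℂ)), ∀ w ∈ (M.nonInv : Set (NonStd U ℂ)),
      z * w ∈ M.nonInv := by
  rintro z hz w ⟨hw1, hw2⟩
  refine ⟨M.toSubring.mul_mem hz hw1, ?_⟩
  by_contra! hc
  have hw0 : w ≠ 0 := right_ne_zero_of_mul hc.1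
  have hz0 : z ≠ 0 := left_ne_zero_of_mul hc.1
  refine hw2.elim hw0 fun h => h ?_
  have := M.toSubring.mul_mem hz hc.2
  rwa [mul_inv, ← mul_assoc, mul_inv_cancel₀ hz0, one_mul] at this

/-! ### `𝓜`-asymptotic functions -/

section Asymptotic

variable {U : Ultrafilter ι}

/-- The `𝓜`-moderate functions
`𝓜(Ω) = {f ∈ *𝓔(Ω) : ∂^α f(x) ∈ 𝓜 for all α ∈ ℕ₀^d and x ∈ μ(Ω)}`. -/
def moderate (M : ConvexSubring U) (Ω : Opens (Eucl d)) : Subring (NonStdSmooth U Ω) where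
  carrier := {f | ∀ α : Fin d → ℕ, ∀ x ∈ monad U (Ω : Set (Eucl d)),
    eval (starDeriv α f) x ∈ M.toSubring}
  zero_mem' α x _ := by rw [map_zero, eval_zero]; exact zero_mem _
  one_mem' α x hx := by
    rcases starDeriv_one (α := α) (monad_subset_starSet U Ω hx) with h | h
    · rw [h]; exact zero_mem _
    · rw [h]; exact one_mem _
  add_mem' hf hg α x hx := by
    rw [map_add, eval_add]; exact add_mem (hf α x hx) (hg α x hx)
  neg_mem' hf α x hx := by
    rw [map_neg, eval_neg]; exact neg_mem (hf α x hx)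
  mul_mem' {f g} hf hg α x hx :=
    eval_starDeriv_mul_mem (A := M.toSubring) (B := M.toSubring)
      (C := M.toSubring.toAddSubgroup) (fun _ ha _ hb => M.toSubring.mul_mem ha hb) α f g
      (fun β => hf β x hx) (fun β => hg β x hx)

/-- The `𝓜`-negligible functions
`𝓜₀(Ω) = {f ∈ *𝓔(Ω) : ∂^α f(x) ∈ 𝓜₀ for all α ∈ ℕ₀^d and x ∈ μ(Ω)}`, as an ideal of `𝓜(Ω)`. (They
are moderate since `𝓜₀ ⊆ 𝓜`.) -/
def negligible (M : ConvexSubring U) (Ω : Opens (Eucl d)) : Ideal (moderate M Ω) where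
  carrier := {f | ∀ α : Fin d → ℕ, ∀ x ∈ monad U (Ω : Set (Eucl d)),
    eval (starDeriv α (f : NonStdSmooth U Ω)) x ∈ M.nonInv}
  zero_mem' α x _ := by
    change eval (starDeriv α (0 : NonStdSmooth U Ω)) x ∈ _
    rw [map_zero, eval_zero]; exact zero_mem _
  add_mem' {f g} hf hg α x hx := by
    change eval (starDeriv α ((f : NonStdSmooth U Ω) + (g : NonStdSmooth U Ω))) x ∈ _
    rw [map_add, eval_add]; exact add_mem (hf α x hx) (hg α x hx)
  smul_mem' f g hg α x hx := by
    change eval (starDeriv α ((f : NonStdSmooth U Ω) * (g : NonStdSmooth U Ω))) x ∈ M.nonInv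
    exact eval_starDeriv_mul_mem M.mul_nonInv α (f : NonStdSmooth U Ω) (g : NonStdSmooth U Ω)
      (fun β => f.2 β x hx) (fun β => hg β x hx)

/-- The ring `𝓜(Ω)/𝓜₀(Ω)` of `𝓜`-asymptotic functions on `Ω`. -/
def Asymp (M : ConvexSubring U) (Ω : Opens (Eucl d)) := moderate M Ω ⧸ negligible M Ω

instance (M : ConvexSubring U) (Ω : Opens (Eucl d)) : CommRing (Asymp M Ω) :=
  inferInstanceAs (CommRing (moderate M Ω ⧸ negligible M Ω))

/-- The quotient map `f ↦ f̂` from `𝓜(Ω)` onto the ring of asymptotic functions. -/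
def toAsymp (M : ConvexSubring U) (Ω : Opens (Eucl d)) : moderate M Ω →+* Asymp M Ω :=
  Ideal.Quotient.mk (negligible M Ω)

theorem toAsymp_surjective (M : ConvexSubring U) (Ω : Opens (Eucl d)) :
    Function.Surjective (toAsymp M Ω) := Ideal.Quotient.mk_surjective

theorem toAsymp_eq_zero_iff {M : ConvexSubring U} {Ω : Opens (Eucl d)} (f : moderate M Ω) :
    toAsymp M Ω f = 0 ↔ f ∈ negligible M Ω := Ideal.Quotient.eq_zero_iff_mem

/-- `∂^α` on `𝓜(Ω)`. -/
def modDeriv (M : ConvexSubring U) (Ω : Opens (Eucl d)) (α : Fin d → ℕ) :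
    moderate M Ω →+ moderate M Ω where
  toFun f := ⟨starDeriv α (f : NonStdSmooth U Ω), fun β x hx => by
    rw [← starDeriv_add]; exact f.2 (β + α) x hx⟩
  map_zero' := Subtype.ext (map_zero (starDeriv α))
  map_add' f g := Subtype.ext (map_add (starDeriv α) (f : NonStdSmooth U Ω) g)

/-- `∂^α` of the class of `f` is the class of `∂^α f`. -/
def asympDeriv {M : ConvexSubring U} {Ω : Opens (Eucl d)} (α : Fin d → ℕ) :
    Asymp M Ω → Asymp M Ω :=
  Quotient.map' (modDeriv M Ω α) fun f g h => by
    rw [Submodule.quotientRel_def] at h ⊢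
    intro β x hx
    have h1 := h (β + α) x hx
    rw [starDeriv_add] at h1
    rw [← map_sub]
    exact h1

/-- The restriction `f ↦ f|*𝓞` from `𝓜(Ω)` to `𝓜(𝓞)`. -/
def modRestrict (M : ConvexSubring U) {O Ω : Opens (Eucl d)} (h : O ≤ Ω) :
    moderate M Ω →+* moderate M O :=
  RingHom.codRestrict ((starRestrict U h).comp (moderate M Ω).subtype) (moderate M O)
    fun f α x hx => by
      change eval (starDeriv α (starRestrict U h (f : NonStdSmooth U Ω))) x ∈ _
      rw [starDeriv_starRestrict, eval_starRestrict h _ (monad_subset_starSet U O hx)]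
      exact f.2 α x (monad_mono U h hx)

theorem modRestrict_mem {M : ConvexSubring U} {O Ω : Opens (Eucl d)} (h : O ≤ Ω)
    (f : moderate M Ω) (hf : f ∈ negligible M Ω) : modRestrict M h f ∈ negligible M O := by
  intro α x hx
  have h1 : eval (starDeriv α (f : NonStdSmooth U Ω)) x ∈ M.nonInv := hf α x (monad_mono U h hx)
  have h2 : ((modRestrict M h f : moderate M O) : NonStdSmooth U O) =
    starRestrict U h (f : NonStdSmooth U Ω) := rfl
  rw [h2, starDeriv_starRestrict, eval_starRestrict h _ (monad_subset_starSet U O hx)]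
  exact h1

theorem negligible_le_comap (M : ConvexSubring U) {O Ω : Opens (Eucl d)} (h : O ≤ Ω) :
    negligible M Ω ≤ (negligible M O).comap (modRestrict M h) :=
  fun f hf => modRestrict_mem h f hf

/-- The restriction of asymptotic functions: the class of `f` goes to the class of `f|*𝓞`. -/
def restrict {M : ConvexSubring U} {O Ω : Opens (Eucl d)} (h : O ≤ Ω) :
    Asymp M Ω →+* Asymp M O :=
  Ideal.quotientMap (I := negligible M Ω) (negligible M O) (modRestrict M h)
    (negligible_le_comap M h)

theorem restrict_mk {M : ConvexSubring U} {O Ω : Opens (Eucl d)} (h : O ≤ Ω)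
    (f : moderate M Ω) :
    restrict h (toAsymp M Ω f) =
      toAsymp M O (modRestrict M h f) := rfl

theorem asympDeriv_mk {M : ConvexSubring U} {Ω : Opens (Eucl d)} (α : Fin d → ℕ)
    (f : moderate M Ω) :
    asympDeriv α (toAsymp M Ω f) =
      toAsymp M Ω (modDeriv M Ω α f) := rfl

/-- The open subsets of `Ω` on which the asymptotic function `f` vanishes. -/
def vanishingOpens {M : ConvexSubring U} {Ω : Opens (Eucl d)} (f : Asymp M Ω) :
    Set (Opens (Eucl d)) :=
  {O | ∃ h : O ≤ Ω, restrict h f = 0}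

/-- The (standard) support of `f`: the complement in `Ω` of the union of all open subsets of `Ω` on
which `f` vanishes. -/
def supp {M : ConvexSubring U} {Ω : Opens (Eucl d)} (f : Asymp M Ω) : Set (Eucl d) :=
  (Ω : Set (Eucl d)) \ (sSup (vanishingOpens f) : Opens (Eucl d))

end Asymptotic

/-- The members of an open covering of `Ω` are contained in `Ω`. -/
theorem le_of_cover {Λ : Type*} {Ωs : Λ → Opens (Eucl d)} {Ω : Opens (Eucl d)}
    (h : ⨆ l, Ωs l = Ω) (l : Λ) : Ωs l ≤ Ω := h ▸ le_iSup Ωs l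

end AsymptoticFunctions

end

open AsymptoticFunctions

/-!
A point of `μ(Ω)` is infinitely close to some `r ∈ Ω`, so it lies in `μ(V)` for every
neighbourhood `V` of `r`, and a derivative of `f` takes the same value there as the derivative of
`f|*V`. Hence being moderate and being negligible are local conditions, which gives (iii) and the
largest open set on which an asymptotic function vanishes.

For (iv), take a smooth partition of unity `(ρₗ)` subordinate to the covering, representatives
`fₗ = ⟨fₗᵢ⟩`, and let `f = ⟨∑ₗ ρₗ fₗᵢ⟩`. Near a standard point of `Ω` only finitely many `ρₗ` are
nonzero, and this finite set does not depend on `i`. So `f` is locally a finite sum `∑ₗ ρₗ fₗ`. It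
is moderate because the standard functions `ρₗ` are: they are bounded near each standard point and
`𝓜` contains all finite numbers, by convexity. On `Ωₖ` each `f̂ₗ` may be replaced by `f̂ₖ`, so
`f̂ = (∑ₗ ρₗ) f̂ₖ = f̂ₖ` there.
-/

namespace AsymptoticFunctions

open scoped Manifold

variable {d : ℕ} {Ω O V : Opens (Eucl d)}

section PartitionOfUnity

theorem mem_smooth_iff_contMDiff {f : Ω → ℂ} :
    f ∈ Smooth Ω ↔ ContMDiff 𝓘(ℝ, Eucl d) 𝓘(ℝ, ℂ) ∞ f := by
  have hf : f = fun x : Ω => extend Ω f x := funext fun x => (extend_of_mem f x.2).symm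
  change ContDiffOn ℝ ∞ (extend Ω f) Ω ↔ _
  rw [Ω.isOpen.contDiffOn_iff]
  conv_rhs => rw [hf]
  exact ⟨fun h x => contMDiffAt_subtype_iff.2 (h x.2).contMDiffAt,
    fun h r hr => (contMDiffAt_subtype_iff.1 (h ⟨r, hr⟩)).contDiffAt⟩

variable {Λ : Type*} {Ωs : Λ → Opens (Eucl d)}

theorem exists_isSubordinate_of_le_iSup (hcov : Ω ≤ ⨆ l, Ωs l) :
    ∃ ρ : SmoothPartitionOfUnity Λ 𝓘(ℝ, Eucl d) Ω,
      ρ.IsSubordinate fun l => ((↑) ⁻¹' (Ωs l : Set (Eucl d)) : Set Ω) := by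
  have : LocallyCompactSpace Ω := Ω.2.locallyCompactSpace
  refine SmoothPartitionOfUnity.exists_isSubordinate 𝓘(ℝ, Eucl d) isClosed_univ _
    (fun l => (Ωs l).2.preimage continuous_subtype_val) fun x _ => ?_
  obtain ⟨l, hl⟩ := Opens.mem_iSup.1 (hcov x.2)
  exact Set.mem_iUnion.2 ⟨l, hl⟩

variable {ρ : SmoothPartitionOfUnity Λ 𝓘(ℝ, Eucl d) Ω}

/-- The function `ρₗ` of a partition of unity, as an element of `𝓔(Ω)`. -/
noncomputable def Smooth.weight (ρ : SmoothPartitionOfUnity Λ 𝓘(ℝ, Eucl d) Ω) (l : Λ) :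
    Smooth Ω :=
  ⟨fun x => (ρ l x : ℂ), mem_smooth_iff_contMDiff.2
    ((Complex.ofRealCLM.contDiff.contMDiff (n := ∞)).comp (ρ l).contMDiff)⟩

/-- The smooth function `∑ₗ ρₗ gₗ` on `Ω` glued from functions `gₗ ∈ 𝓔(Ωₗ)` by a subordinate
partition of unity. -/
noncomputable def Smooth.glue
    (hρ : ρ.IsSubordinate fun l => ((↑) ⁻¹' (Ωs l : Set (Eucl d)) : Set Ω))
    (g : ∀ l, Smooth (Ωs l)) : Smooth Ω :=
  ⟨fun x => ∑ᶠ l, ρ l x • extend (Ωs l) (g l) x, mem_smooth_iff_contMDiff.2 <|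
    ρ.contMDiff_finsum_smul fun l _ hx =>
      contMDiffAt_subtype_iff.2 (smooth_contDiffAt (g l) (hρ l hx)).contMDiffAt⟩

/-- `V ⊆ Ω` is adapted to the partition of unity `ρ`, with index set `F`: only the finitely many
`ρₗ` with `l ∈ F` can be nonzero on `V`, and `V ⊆ Ωₗ` for these. A glued function is then, on
`V`, a finite sum of functions that are each defined on all of `V`. -/
structure IsAdapted (ρ : SmoothPartitionOfUnity Λ 𝓘(ℝ, Eucl d) Ω) (Ωs : Λ → Opens (Eucl d))
    (V : Opens (Eucl d)) (F : Finset Λ) : Prop where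
  le : V ≤ Ω
  le_of_mem {l : Λ} : l ∈ F → V ≤ Ωs l
  apply_eq_zero {l : Λ} {x : Ω} : l ∉ F → (x : Eucl d) ∈ V → ρ l x = 0

theorem IsAdapted.mono {F : Finset Λ} {V W : Opens (Eucl d)} (hV : IsAdapted ρ Ωs V F)
    (h : W ≤ V) : IsAdapted ρ Ωs W F where
  le := h.trans hV.le
  le_of_mem hl := h.trans (hV.le_of_mem hl)
  apply_eq_zero hl hx := hV.apply_eq_zero hl (h hx)

theorem exists_isAdapted
    (hρ : ρ.IsSubordinate fun l => ((↑) ⁻¹' (Ωs l : Set (Eucl d)) : Set Ω))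
    {r : Eucl d} (hr : r ∈ Ω) : ∃ V F, r ∈ V ∧ IsAdapted ρ Ωs V F := by
  set F := ρ.fintsupport ⟨r, hr⟩
  have zero_off : ∀ᶠ y : Ω in 𝓝 ⟨r, hr⟩, ∀ l ∉ F, ρ l y = 0 := by
    filter_upwards [ρ.eventually_finsupport_subset ⟨r, hr⟩] with y hy l hl
    by_contra hne
    exact hl (hy ((ρ.mem_finsupport y).2 hne))
  have mem_cover : ∀ᶠ y : Ω in 𝓝 ⟨r, hr⟩, ∀ l ∈ F, (y : Eucl d) ∈ Ωs l :=
    (Filter.eventually_all_finset F).2 fun l hl =>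
      ((Ωs l).2.preimage continuous_subtype_val).mem_nhds
        (hρ l ((ρ.mem_fintsupport_iff _ l).1 hl))
  obtain ⟨W, hW, hWopen, hrW⟩ := eventually_nhds_iff.1 (zero_off.and mem_cover)
  refine ⟨⟨(↑) '' W, Ω.2.isOpenMap_subtype_val W hWopen⟩, F, ⟨_, hrW, rfl⟩, ?_, ?_, ?_⟩
  · rintro _ ⟨y, -, rfl⟩
    exact y.2
  · rintro l hl _ ⟨y, hy, rfl⟩
    exact (hW y hy).2 l hl
  · rintro l _ hl ⟨y, hy, hyx⟩
    exact Subtype.ext hyx ▸ (hW y hy).1 l hl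

theorem IsAdapted.sum_restrict_weight {F : Finset Λ} (hV : IsAdapted ρ Ωs V F) :
    ∑ l : F, Smooth.restrict hV.le (Smooth.weight ρ l) = 1 := by
  ext x
  let y : Ω := ⟨x, hV.le x.2⟩
  have hsupp : (fun l => ρ l y).support ⊆ F := fun l hl => by
    by_contra hlF
    exact hl (hV.apply_eq_zero hlF x.2)
  rw [AddSubmonoidClass.coe_finsetSum, Finset.sum_apply]
  calc ∑ l : F, ((ρ l y : ℝ) : ℂ) = ((∑ l ∈ F, ρ l y : ℝ) : ℂ) := by
        rw [Finset.sum_coe_sort F fun l => ((ρ l y : ℝ) : ℂ), Complex.ofReal_sum]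
    _ = 1 := by
        rw [← finsum_eq_sum_of_support_subset _ hsupp, ρ.sum_eq_one (Set.mem_univ y),
          Complex.ofReal_one]

theorem IsAdapted.restrict_glue {F : Finset Λ} (hV : IsAdapted ρ Ωs V F)
    (hρ : ρ.IsSubordinate fun l => ((↑) ⁻¹' (Ωs l : Set (Eucl d)) : Set Ω))
    (g : ∀ l, Smooth (Ωs l)) :
    Smooth.restrict hV.le (Smooth.glue hρ g) =
      ∑ l : F, Smooth.restrict hV.le (Smooth.weight ρ l) *
        Smooth.restrict (hV.le_of_mem l.2) (g l) := by
  ext x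
  let y : Ω := ⟨x, hV.le x.2⟩
  have hsupp : (fun l => ρ l y • extend (Ωs l) (g l) x).support ⊆ F := fun l hl => by
    by_contra hlF
    exact hl (by simp only [hV.apply_eq_zero (x := y) hlF x.2, zero_smul])
  rw [AddSubmonoidClass.coe_finsetSum, Finset.sum_apply]
  calc ∑ᶠ l, ρ l y • extend (Ωs l) (g l) x
      = ∑ l : F, ρ l y • extend (Ωs l) (g l) x := by
        rw [finsum_eq_sum_of_support_subset _ hsupp,
          Finset.sum_coe_sort F fun l => ρ l y • extend (Ωs l) (g l) x]
    _ = _ := Finset.sum_congr rfl fun l _ => by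
        rw [extend_of_mem _ (hV.le_of_mem l.2 x.2), Complex.real_smul]
        rfl

end PartitionOfUnity

variable {ι : Type*} {U : Ultrafilter ι}

section Monad

theorem exists_mem_monad_singleton {X : Set (Eucl d)} {x : NonStd U (Eucl d)}
    (hx : x ∈ monad U X) : ∃ r ∈ X, x ∈ monad U {r} := by
  obtain ⟨r, hr, dx, hdx, rfl⟩ := hx
  exact ⟨r, hr, r, rfl, dx, hdx, rfl⟩

theorem liftPred_of_mem_monad_singleton {r : Eucl d} {x : NonStd U (Eucl d)}
    (hx : x ∈ monad U {r}) {p : Eucl d → Prop} (hp : ∀ᶠ y in 𝓝 r, p y) :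
    Germ.LiftPred p x := by
  obtain ⟨_, rfl, dx, hdx, rfl⟩ := hx
  obtain ⟨ε, hε, hball⟩ := Metric.eventually_nhds_iff.1 hp
  have hlt := hdx ε hε
  induction dx using Germ.inductionOn with
  | h v =>
    refine Germ.liftPred_coe.2 ?_
    filter_upwards [Germ.coe_lt.1 hlt] with i hi
    exact hball (by simpa [dist_eq_norm] using hi)

theorem eval_starDeriv_starRestrict (h : O ≤ Ω) (α : Fin d → ℕ) (f : NonStdSmooth U Ω)
    {x : NonStd U (Eucl d)} (hx : x ∈ monad U (O : Set (Eucl d))) :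
    eval (starDeriv α (starRestrict U h f)) x = eval (starDeriv α f) x := by
  rw [starDeriv_starRestrict, eval_starRestrict h _ (monad_subset_starSet U O hx)]

theorem eval_starDeriv_mem_of_local {S : Type*} [SetLike S (NonStd U ℂ)] {A : S}
    {f : NonStdSmooth U Ω} {α : Fin d → ℕ}
    (h : ∀ r ∈ Ω, ∃ V : Opens (Eucl d), r ∈ V ∧ ∃ hV : V ≤ Ω,
      ∀ x ∈ monad U (V : Set (Eucl d)), eval (starDeriv α (starRestrict U hV f)) x ∈ A) :
    ∀ x ∈ monad U (Ω : Set (Eucl d)), eval (starDeriv α f) x ∈ A := by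
  intro x hx
  obtain ⟨r, hr, hxr⟩ := exists_mem_monad_singleton hx
  obtain ⟨V, hrV, hV, hVA⟩ := h r hr
  have hxV : x ∈ monad U (V : Set (Eucl d)) := monad_mono U (Set.singleton_subset_iff.2 hrV) hxr
  rw [← eval_starDeriv_starRestrict hV α f hxV]
  exact hVA x hxV

end Monad

variable {M : ConvexSubring U}

section StandardFunctions

theorem ConvexSubring.mem_of_absval_le_real (M : ConvexSubring U) {z : NonStd U ℂ} {C : ℝ}
    (h : absval z ≤ (C : NonStd U ℝ)) : z ∈ M.toSubring := by
  obtain ⟨n, hn⟩ := exists_nat_ge C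
  refine M.convex' z ((n : ℂ) : NonStd U ℂ) (natCast_mem M.toSubring n) (h.trans ?_)
  exact Germ.coe_le.2 (Eventually.of_forall fun _ => hn.trans_eq (Complex.norm_natCast n).symm)

theorem eval_const_mem (M : ConvexSubring U) (f : Smooth Ω) {x : NonStd U (Eucl d)}
    (hx : x ∈ monad U (Ω : Set (Eucl d))) : eval (f : NonStdSmooth U Ω) x ∈ M.toSubring := by
  obtain ⟨r, hr, hxr⟩ := exists_mem_monad_singleton hx
  have hbound : ∀ᶠ y in 𝓝 r, ‖extend Ω f y‖ < ‖extend Ω f r‖ + 1 :=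
    (smooth_contDiffAt f hr).continuousAt.norm.eventually_lt_const (lt_add_one _)
  have hlift := liftPred_of_mem_monad_singleton hxr hbound
  refine M.mem_of_absval_le_real (C := ‖extend Ω f r‖ + 1) ?_
  induction x using Germ.inductionOn with
  | h v => exact Germ.coe_le.2 (hlift.mono fun _ => le_of_lt)

theorem const_mem_moderate (M : ConvexSubring U) (f : Smooth Ω) :
    (f : NonStdSmooth U Ω) ∈ moderate M Ω :=
  fun α _ hx => eval_const_mem M (mderiv α f) hx

/-- The embedding `𝓔(Ω) → 𝓜(Ω)` of the standard smooth functions as constant families. -/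
def modOfSmooth (M : ConvexSubring U) : Smooth Ω →+* moderate M Ω :=
  ((Germ.coeRingHom (U : Filter ι)).comp (Pi.constRingHom ι (Smooth Ω))).codRestrict
    (moderate M Ω) (const_mem_moderate M)

end StandardFunctions

section Locality

theorem mem_moderate_of_local {f : NonStdSmooth U Ω}
    (h : ∀ r ∈ Ω, ∃ V : Opens (Eucl d), r ∈ V ∧ ∃ hV : V ≤ Ω,
      starRestrict U hV f ∈ moderate M V) : f ∈ moderate M Ω :=
  fun α => eval_starDeriv_mem_of_local (A := M.toSubring) fun r hr =>
    let ⟨V, hrV, hV, hf⟩ := h r hr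
    ⟨V, hrV, hV, hf α⟩

theorem eq_zero_of_local {f : Asymp M Ω}
    (h : ∀ r ∈ Ω, ∃ V : Opens (Eucl d), r ∈ V ∧ ∃ hV : V ≤ Ω, restrict hV f = 0) : f = 0 := by
  obtain ⟨f, rfl⟩ := toAsymp_surjective M Ω f
  refine (toAsymp_eq_zero_iff f).2 fun α =>
    eval_starDeriv_mem_of_local (A := M.nonInv) fun r hr => ?_
  obtain ⟨V, hrV, hV, hf⟩ := h r hr
  exact ⟨V, hrV, hV, (toAsymp_eq_zero_iff (modRestrict M hV f)).1 hf α⟩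

theorem eq_zero_of_restrict_cover_eq_zero {Λ : Type*} {Ωs : Λ → Opens (Eucl d)}
    (hcov : ⨆ l, Ωs l = Ω) {f : Asymp M Ω}
    (h : ∀ l, restrict (le_of_cover hcov l) f = 0) : f = 0 :=
  eq_zero_of_local fun _ hr =>
    let ⟨l, hl⟩ := Opens.mem_iSup.1 (hcov.ge hr)
    ⟨Ωs l, hl, le_of_cover hcov l, h l⟩

end Locality

section Presheaf

theorem restrict_rfl (f : Asymp M Ω) : restrict le_rfl f = f := by
  obtain ⟨⟨f, hf⟩, rfl⟩ := toAsymp_surjective M Ω f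
  refine congrArg (toAsymp M Ω) (Subtype.ext ?_)
  induction f using Germ.inductionOn with
  | h f => rfl

theorem restrict_restrict (h₁ : V ≤ O) (h₂ : O ≤ Ω) (f : Asymp M Ω) :
    restrict h₁ (restrict h₂ f) = restrict (h₁.trans h₂) f := by
  obtain ⟨⟨f, hf⟩, rfl⟩ := toAsymp_surjective M Ω f
  refine congrArg (toAsymp M V) (Subtype.ext ?_)
  induction f using Germ.inductionOn with
  | h f => rfl

theorem restrict_eq_restrict_of_restrict_inf_eq {Ω₁ Ω₂ : Opens (Eucl d)} {f₁ : Asymp M Ω₁}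
    {f₂ : Asymp M Ω₂}
    (h : restrict (inf_le_left : Ω₁ ⊓ Ω₂ ≤ Ω₁) f₁ = restrict (inf_le_right : Ω₁ ⊓ Ω₂ ≤ Ω₂) f₂)
    (h₁ : V ≤ Ω₁) (h₂ : V ≤ Ω₂) : restrict h₁ f₁ = restrict h₂ f₂ := by
  rw [← restrict_restrict (le_inf h₁ h₂) inf_le_left, h, restrict_restrict]

theorem asympDeriv_zero (f : Asymp M Ω) : asympDeriv 0 f = f := by
  obtain ⟨f, rfl⟩ := toAsymp_surjective M Ω f
  exact congrArg (toAsymp M Ω) (Subtype.ext (starDeriv_zero f.1))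

theorem asympDeriv_index_add (α β : Fin d → ℕ) (f : Asymp M Ω) :
    asympDeriv (α + β) f = asympDeriv α (asympDeriv β f) := by
  obtain ⟨f, rfl⟩ := toAsymp_surjective M Ω f
  exact congrArg (toAsymp M Ω) (Subtype.ext (starDeriv_add α β f.1))

theorem asympDeriv_add (α : Fin d → ℕ) (f g : Asymp M Ω) :
    asympDeriv α (f + g) = asympDeriv α f + asympDeriv α g := by
  obtain ⟨f, rfl⟩ := toAsymp_surjective M Ω f
  obtain ⟨g, rfl⟩ := toAsymp_surjective M Ω g
  exact congrArg (toAsymp M Ω) (map_add (modDeriv M Ω α) f g)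

theorem asympDeriv_single_mul (i : Fin d) (f g : Asymp M Ω) :
    asympDeriv (Pi.single i 1) (f * g) =
      asympDeriv (Pi.single i 1) f * g + f * asympDeriv (Pi.single i 1) g := by
  obtain ⟨f, rfl⟩ := toAsymp_surjective M Ω f
  obtain ⟨g, rfl⟩ := toAsymp_surjective M Ω g
  exact congrArg (toAsymp M Ω) (Subtype.ext (starDeriv_single_mul i f.1 g.1))

theorem restrict_asympDeriv (h : O ≤ Ω) (α : Fin d → ℕ) (f : Asymp M Ω) :
    restrict h (asympDeriv α f) = asympDeriv α (restrict h f) := by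
  obtain ⟨f, rfl⟩ := toAsymp_surjective M Ω f
  exact congrArg (toAsymp M O) (Subtype.ext (starDeriv_starRestrict h α f.1).symm)

end Presheaf

section Gluing

variable {Λ : Type*} {Ωs : Λ → Opens (Eucl d)} {ρ : SmoothPartitionOfUnity Λ 𝓘(ℝ, Eucl d) Ω}
  (hρ : ρ.IsSubordinate fun l => ((↑) ⁻¹' (Ωs l : Set (Eucl d)) : Set Ω))

/-- `⟨∑ₗ ρₗ fₗᵢ⟩`, where `⟨fₗᵢ⟩ = fₗ`. If infinitely many `ρₗ` are nonzero it depends on the chosen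
representatives `fₗᵢ`, since `U` need not be closed under infinite intersections. -/
noncomputable def starGlue (f : ∀ l, NonStdSmooth U (Ωs l)) : NonStdSmooth U Ω :=
  Germ.ofFun fun i => Smooth.glue hρ fun l => Quotient.out (f l) i

variable {F : Finset Λ}

theorem IsAdapted.starRestrict_starGlue (hV : IsAdapted ρ Ωs V F)
    (f : ∀ l, NonStdSmooth U (Ωs l)) :
    starRestrict U hV.le (starGlue hρ f) =
      ∑ l : F, (Smooth.restrict hV.le (Smooth.weight ρ l) : NonStdSmooth U V) *
        starRestrict U (hV.le_of_mem l.2) (f l) := by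
  have hout (l : Λ) : Germ.ofFun (Quotient.out (f l)) = f l := Quotient.out_eq (f l)
  calc starRestrict U hV.le (starGlue hρ f)
      = Germ.coeRingHom (U : Filter ι) (∑ l : F, fun i =>
          Smooth.restrict hV.le (Smooth.weight ρ l) *
            Smooth.restrict (hV.le_of_mem l.2) (Quotient.out (f l) i)) := by
        refine congrArg Germ.ofFun (funext fun i => ?_)
        rw [Finset.sum_apply]
        exact hV.restrict_glue hρ _
    _ = ∑ l : F, (Smooth.restrict hV.le (Smooth.weight ρ l) : NonStdSmooth U V) *
          starRestrict U (hV.le_of_mem l.2) (Germ.ofFun (Quotient.out (f l))) :=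
        map_sum _ _ _
    _ = _ := by simp only [hout]

theorem starGlue_mem_moderate (f : ∀ l, moderate M (Ωs l)) :
    starGlue hρ (fun l => (f l : NonStdSmooth U (Ωs l))) ∈ moderate M Ω := by
  refine mem_moderate_of_local fun r hr => ?_
  obtain ⟨V, F, hrV, hV⟩ := exists_isAdapted hρ hr
  refine ⟨V, hrV, hV.le, ?_⟩
  rw [hV.starRestrict_starGlue hρ]
  exact sum_mem fun l _ =>
    mul_mem (const_mem_moderate M _) (modRestrict M (hV.le_of_mem l.2) (f l)).2

/-- `⟨∑ₗ ρₗ fₗᵢ⟩` as an element of `𝓜(Ω)`, for moderate functions `fₗ = ⟨fₗᵢ⟩` on `Ωₗ`. It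
represents the amalgamation of the classes `f̂ₗ` when these agree on overlaps. -/
noncomputable def modGlue (f : ∀ l, moderate M (Ωs l)) : moderate M Ω :=
  ⟨starGlue hρ fun l => (f l : NonStdSmooth U (Ωs l)), starGlue_mem_moderate hρ f⟩

theorem IsAdapted.modRestrict_modGlue (hV : IsAdapted ρ Ωs V F) (f : ∀ l, moderate M (Ωs l)) :
    modRestrict M hV.le (modGlue hρ f) =
      ∑ l : F, modOfSmooth M (Smooth.restrict hV.le (Smooth.weight ρ l)) *
        modRestrict M (hV.le_of_mem l.2) (f l) := by
  refine Subtype.ext ((hV.starRestrict_starGlue hρ _).trans ?_)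
  rw [AddSubmonoidClass.coe_finsetSum]
  rfl

theorem IsAdapted.restrict_toAsymp_modGlue (hV : IsAdapted ρ Ωs V F)
    (f : ∀ l, moderate M (Ωs l)) {g : Asymp M V}
    (hg : ∀ l (hl : l ∈ F), restrict (hV.le_of_mem hl) (toAsymp M (Ωs l) (f l)) = g) :
    restrict hV.le (toAsymp M Ω (modGlue hρ f)) = g := by
  let ψ (l : F) : Asymp M V :=
    toAsymp M V (modOfSmooth M (Smooth.restrict hV.le (Smooth.weight ρ l)))
  have sum_ψ : ∑ l, ψ l = 1 := by
    simp only [ψ, ← map_sum, hV.sum_restrict_weight, map_one]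
  calc restrict hV.le (toAsymp M Ω (modGlue hρ f))
      = ∑ l : F, ψ l * restrict (hV.le_of_mem l.2) (toAsymp M (Ωs l) (f l)) := by
        simp only [restrict_mk, hV.modRestrict_modGlue hρ f, map_sum, map_mul, ψ]
    _ = ∑ l : F, ψ l * g := Finset.sum_congr rfl fun l _ => by rw [hg l l.2]
    _ = g := by rw [← Finset.sum_mul, sum_ψ, one_mul]

theorem exists_restrict_eq (hcov : ⨆ l, Ωs l = Ω) (fs : ∀ l, Asymp M (Ωs l))
    (hfs : ∀ l₁ l₂, ((Ωs l₁ : Set (Eucl d)) ∩ Ωs l₂).Nonempty →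
      restrict (inf_le_left : Ωs l₁ ⊓ Ωs l₂ ≤ Ωs l₁) (fs l₁) =
        restrict (inf_le_right : Ωs l₁ ⊓ Ωs l₂ ≤ Ωs l₂) (fs l₂)) :
    ∃ f : Asymp M Ω, ∀ l, restrict (le_of_cover hcov l) f = fs l := by
  obtain ⟨ρ, hρ⟩ := exists_isSubordinate_of_le_iSup hcov.ge
  choose f hf using fun l => toAsymp_surjective M (Ωs l) (fs l)
  refine ⟨toAsymp M Ω (modGlue hρ f), fun l => sub_eq_zero.1 (eq_zero_of_local fun r hr => ?_)⟩
  obtain ⟨V, F, hrV, hV⟩ := exists_isAdapted hρ (le_of_cover hcov l hr)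
  have hW : IsAdapted ρ Ωs (V ⊓ Ωs l) F := hV.mono inf_le_left
  refine ⟨V ⊓ Ωs l, ⟨hrV, hr⟩, inf_le_right, ?_⟩
  rw [map_sub, restrict_restrict, sub_eq_zero]
  refine hW.restrict_toAsymp_modGlue hρ f fun k hk => ?_
  rw [hf k]
  exact restrict_eq_restrict_of_restrict_inf_eq (hfs k l ⟨r, hV.le_of_mem hk hrV, hr⟩) _ _

end Gluing

section Support

theorem isGreatest_sSup_vanishingOpens (f : Asymp M Ω) :
    IsGreatest (vanishingOpens f) (sSup (vanishingOpens f)) := by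
  refine ⟨⟨sSup_le fun O hO => hO.1, eq_zero_of_local fun r hr => ?_⟩, fun O hO => le_sSup hO⟩
  obtain ⟨O, hO, hrO⟩ := Opens.mem_sSup.1 hr
  exact ⟨O, hrO, le_sSup hO, (restrict_restrict _ _ f).trans hO.2⟩

theorem isClosed_preimage_supp (f : Asymp M Ω) : IsClosed ((↑) ⁻¹' supp f : Set Ω) := by
  rw [supp, Set.preimage_sdiff, Subtype.coe_preimage_self, ← Set.compl_eq_univ_sdiff]
  exact ((sSup (vanishingOpens f)).2.preimage continuous_subtype_val).isClosed_compl

end Support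

end AsymptoticFunctions

theorem mainTheorem11 {d : ℕ} {ι : Type*} (U : Ultrafilter ι) (M : ConvexSubring U) :
    -- each member of the family is a (commutative) differential ring
    (∀ (Ω : Opens (Eucl d)) (f g : Asymp M Ω),
      asympDeriv 0 f = f ∧
      (∀ α β : Fin d → ℕ, asympDeriv (α + β) f = asympDeriv α (asympDeriv β f)) ∧
      (∀ α : Fin d → ℕ, asympDeriv α (f + g) = asympDeriv α f + asympDeriv α g) ∧
      (∀ i : Fin d, asympDeriv (Pi.single i 1) (f * g) =
        asympDeriv (Pi.single i 1) f * g + f * asympDeriv (Pi.single i 1) g)) ∧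
    -- (i)
    (∀ (Ω : Opens (Eucl d)) (f : Asymp M Ω), restrict le_rfl f = f) ∧
    -- (ii)
    (∀ (Ω₁ Ω₂ Ω : Opens (Eucl d)) (h₁ : Ω₁ ≤ Ω₂) (h₂ : Ω₂ ≤ Ω) (f : Asymp M Ω),
      restrict h₁ (restrict h₂ f) = restrict (h₁.trans h₂) f) ∧
    -- (iii) and (iv), for every open covering
    (∀ {Λ : Type*} (Ωs : Λ → Opens (Eucl d)) (Ω : Opens (Eucl d)) (hcov : ⨆ l, Ωs l = Ω),
      (∀ f : Asymp M Ω, (∀ l, restrict (le_of_cover hcov l) f = 0) → f = 0) ∧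
      (∀ fs : ∀ l, Asymp M (Ωs l),
        (∀ l₁ l₂, ((Ωs l₁ : Set (Eucl d)) ∩ Ωs l₂).Nonempty →
          restrict (inf_le_left : Ωs l₁ ⊓ Ωs l₂ ≤ Ωs l₁) (fs l₁) =
            restrict (inf_le_right : Ωs l₁ ⊓ Ωs l₂ ≤ Ωs l₂) (fs l₂)) →
        ∃ f : Asymp M Ω, ∀ l, restrict (le_of_cover hcov l) f = fs l)) ∧
    -- (v)
    (∀ (Ω O : Opens (Eucl d)) (h : O ≤ Ω) (f g : Asymp M Ω),
      (∀ α : Fin d → ℕ, restrict h (asympDeriv α f) = asympDeriv α (restrict h f)) ∧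
      restrict h (f + g) = restrict h f + restrict h g ∧
      restrict h (f * g) = restrict h f * restrict h g) ∧
    -- supports: there is a largest open subset of `Ω` on which `f` vanishes, and its complement
    -- `supp f` in `Ω` is closed in `Ω`
    (∀ (Ω : Opens (Eucl d)) (f : Asymp M Ω),
      (∃ O : Opens (Eucl d), IsGreatest (vanishingOpens f) O ∧
        supp f = (Ω : Set (Eucl d)) \ O) ∧
      IsClosed ((↑) ⁻¹' supp f : Set Ω)) := by
  exact ⟨fun Ω f g => ⟨asympDeriv_zero f, fun α β => asympDeriv_index_add α β f,
      fun α => asympDeriv_add α f g, fun i => asympDeriv_single_mul i f g⟩,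
    fun Ω f => restrict_rfl f,
    fun Ω₁ Ω₂ Ω h₁ h₂ f => restrict_restrict h₁ h₂ f,
    fun Ωs Ω hcov => ⟨fun f => eq_zero_of_restrict_cover_eq_zero hcov, exists_restrict_eq hcov⟩,
    fun Ω O h f g => ⟨fun α => restrict_asympDeriv h α f, map_add _ f g, map_mul _ f g⟩,
    fun Ω f => ⟨⟨_, isGreatest_sSup_vanishingOpens f, rfl⟩, isClosed_preimage_supp f⟩⟩
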